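/- Let $(R,\mathfrak m)$ be a one-dimensional Noetherian local domain with infinite residue field $k$ and quotient field $K$. Assume that the integral closure $\overline R$ of $R$ in $K$ is a finite $R$-module and a discrete valuation ring, and that $R$ is residually rational, i.e. the natural map from $k$ to the residue field of $\overline R$ is an isomorphism. Write $\ell$ for the length of $R$-modules and $A:B=\{y\in K : yB\subseteq A\}$ for $R$-submodules $A,B$ of $K$. Let - $h(z)\in\mathbb Z[z]$ be the polynomial with $\sum_{n\ge 0}\ell(\mathfrak m^n/\mathfrak m^{n+1})z^n=h(z)/(1-z)$, and $e=h(1)$ the multiplicity of $R$; - $\mu=\ell(\mathfrak m/\mathfrak m^2)$ be the embedding dimension of $R$, and $r=\ell((R:\mathfrak m)/R)$ its Cohen–Macaulay type; - $\Lambda=\bigcup_{n\ge 0}(\mathfrak m^n:\mathfrak m^n)$ be the blowing-up of $R$ along $\mathfrak m$; - $x\in\mathfrak m$ be a minimal reduction of $\mathfrak m$, i.e. $\mathfrak m^{n+1}=x\mathfrak m^n$ for all $n\gg 0$, and $\nu$ the reduction exponent, i.e. the least integer such that $\mathfrak m^{n+1}=x\mathfrak m^n$ for all $n\ge\nu$.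 Suppose that $e=\mu+1$. Then $\mathfrak m^\nu\subseteq R:\Lambda$ and $$\ell\big((R:\Lambda)/\mathfrak m^\nu\big)=r-1+(e-1)(\nu-2).$$ -/

import Mathlib

open IsLocalRing Polynomial

noncomputable section

namespace BlowUp

/-- The length `ℓ_R(A/B)` of the quotient of two submodules `B ⊆ A` of an `R`-module. -/
def lengthQuot {R M : Type*} [Ring R] [AddCommGroup M] [Module R M] (A B : Submodule R M) : ℕ∞ :=
  Module.length R (A ⧸ B.submoduleOf A)

section Ideals

variable {R : Type*} [CommRing R]

/-- The Hilbert function `H_I(n) = ℓ_R(I^n / I^(n+1))`. -/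
def hilbertFun (I : Ideal R) (n : ℕ) : ℕ :=
  (lengthQuot (I ^ n) (I ^ (n + 1))).toNat

/-- The Hilbert-Poincaré series `P_I(z) = ∑ H_I(n) z^n`. -/
def hilbertSeries (I : Ideal R) : PowerSeries ℤ :=
  PowerSeries.mk fun n => (hilbertFun I n : ℤ)

/-- `h` is the `h`-polynomial of `I`: `P_I(z) = h(z) / (1 - z)`. -/
def IsHPoly (I : Ideal R) (h : ℤ[X]) : Prop :=
  (1 - PowerSeries.X) * hilbertSeries I = (h : PowerSeries ℤ)

open Classical in
/-- The `h`-polynomial of `I` (it exists for primary ideals of the maximal ideal of a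
one-dimensional Noetherian local ring; the value is `0` if it does not exist). -/
def hPoly (I : Ideal R) : ℤ[X] :=
  if h : ∃ p : ℤ[X], IsHPoly I p then h.choose else 0

theorem IsHPoly.hPoly_eq {I : Ideal R} {p : ℤ[X]} (hp : IsHPoly I p) : hPoly I = p := by
  have h : ∃ p : ℤ[X], IsHPoly I p := ⟨p, hp⟩
  have h2 : hPoly I = h.choose := dif_pos h
  rw [h2]
  exact Polynomial.coe_injective ℤ (h.choose_spec.symm.trans hp)

/-- The multiplicity `e(I) = h_I(1)`. -/
def multiplicity (I : Ideal R) : ℤ := (hPoly I).eval 1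

/-- `x` is a minimal reduction of `I`: `x ∈ I` and `I^(n+1) = x I^n` for `n ≫ 0`. -/
def IsMinimalReduction (I : Ideal R) (x : R) : Prop :=
  x ∈ I ∧ ∃ N : ℕ, ∀ n ≥ N, I ^ (n + 1) = Ideal.span {x} * I ^ n

/-- The reduction exponent of `I` with respect to a minimal reduction `x`:
the least `ν` such that `I^(n+1) = x I^n` for all `n ≥ ν`. -/
def reductionExponent (I : Ideal R) (x : R) : ℕ :=
  sInf {N : ℕ | ∀ n ≥ N, I ^ (n + 1) = Ideal.span {x} * I ^ n}

variable (R) in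
/-- The embedding dimension `μ = ℓ_R(m / m^2)` of a local ring. -/
def embDim [IsLocalRing R] : ℕ :=
  (lengthQuot (maximalIdeal R) (maximalIdeal R ^ 2)).toNat

end Ideals

section Fractional

variable {R : Type*} [CommRing R] (K : Type*) [Field K] [Algebra R K]

/-- An ideal of `R` seen inside `K`. -/
abbrev inK (I : Ideal R) : Submodule R K := IsLocalization.coeSubmodule K I

theorem colon_mono (I : Ideal R) :
    Monotone fun n : ℕ => inK K (I ^ n) / inK K (I ^ n) := by
  refine monotone_nat_of_le_succ fun n => ?_
  have h : inK K (I ^ (n + 1)) = inK K (I ^ n) * inK K I := by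
    rw [pow_succ, inK, IsLocalization.coeSubmodule_mul]
  rw [Submodule.le_div_iff_mul_le, h, ← mul_assoc]
  exact mul_le_mul_left (Submodule.le_div_iff_mul_le.mp le_rfl) _

/-- The blowing-up `Λ(I) = ⋃ₙ (I^n : I^n)` of `R` along `I`, as an `R`-submodule of `K`.
For submodules of `K`, `A / B` is the colon `{y ∈ K | y B ⊆ A}`. -/
def blowUp (I : Ideal R) : Submodule R K where
  carrier := ⋃ n : ℕ, ((inK K (I ^ n) / inK K (I ^ n) : Submodule R K) : Set K)
  add_mem' := by
    intro a b ha hb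
    simp only [Set.mem_iUnion, SetLike.mem_coe] at ha hb ⊢
    obtain ⟨i, hi⟩ := ha
    obtain ⟨j, hj⟩ := hb
    exact ⟨max i j, add_mem (colon_mono K I (le_max_left i j) hi)
      (colon_mono K I (le_max_right i j) hj)⟩
  zero_mem' := Set.mem_iUnion.mpr ⟨0, zero_mem _⟩
  smul_mem' := by
    intro c a ha
    simp only [Set.mem_iUnion, SetLike.mem_coe] at ha ⊢
    obtain ⟨i, hi⟩ := ha
    exact ⟨i, Submodule.smul_mem _ c hi⟩

variable (R) in
/-- The Cohen-Macaulay type `r = ℓ_R((R : m) / R)` of a one-dimensional local domain `R`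
with quotient field `K`; here `1` is `R` as a submodule of `K`. -/
def cmType [IsLocalRing R] : ℕ :=
  (lengthQuot ((1 : Submodule R K) / inK K (maximalIdeal R)) 1).toNat

end Fractional

end BlowUp

end

/-! Write `m` for the maximal ideal and `L = R : Λ`. Since `Λ = x^(-ν) m^ν`, the ideal `L` is
`colonPow m x ν`, while `colonPow m x 1 = x(R : m)`. This gives a chain `m^ν ⊆ L ⊆ x(R : m) ⊆ R`,
and the theorem is a length count along it.

Since `ℓ(I/xI) = ℓ(R/xR) = e` for every nonzero ideal `I`, the hypothesis `e = μ + 1` says exactly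
that `ℓ(m^2/xm) = 1`. Then any `a, b ∈ m` with `ab ∉ xm` give `m^(n+2) = x m^(n+1) + (a^(n+1) b)`,
so the Hilbert function equals `e - 1` in degrees `1, ..., ν - 1` and `ℓ(R/m^ν) = 1 + (ν - 1)(e -
1)` (`lengthQuot_top_pow`). Also `ℓ(x(R : m)/xR) = r`, whence `ℓ(R/x(R : m)) = e - r`.

The crux is `ℓ(x(R : m)/L) = 1`, with `x` as generator (`lengthQuot_colonPow`). Here the valuation
enters: `a, b` are chosen with `ab` of maximal order outside `xm` (`exists_maximal_pair`), which
forces products of higher order to be divisible by the required powers of `x`. Subtracting lengths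
gives the formula. -/

open IsLocalRing Polynomial

noncomputable section
namespace BlowUp

/-! ### Lengths of quotients of submodules -/

section Length

variable {R M N : Type*} [Ring R] [AddCommGroup M] [Module R M] [AddCommGroup N] [Module R N]

theorem lengthQuot_add {A B C : Submodule R M} (hCB : C ≤ B) (hBA : B ≤ A) :
    lengthQuot A C = lengthQuot A B + lengthQuot B C := by
  have hf : C.submoduleOf B ≤ (C.submoduleOf A).comap (Submodule.inclusion hBA) :=
    fun y hy => hy
  have hg : C.submoduleOf A ≤ (B.submoduleOf A).comap LinearMap.id := fun y hy => hCB hy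
  rw [add_comm]
  refine Module.length_eq_add_of_exact (Submodule.mapQ _ _ _ hf) (Submodule.mapQ _ _ _ hg) ?_ ?_ ?_
  · rw [← LinearMap.ker_eq_bot, LinearMap.ker_eq_bot']
    intro y hy
    obtain ⟨y, rfl⟩ := Submodule.Quotient.mk_surjective _ y
    rw [Submodule.mapQ_apply, Submodule.Quotient.mk_eq_zero] at hy
    rw [Submodule.Quotient.mk_eq_zero]
    exact hy
  · intro y
    obtain ⟨y, rfl⟩ := Submodule.Quotient.mk_surjective _ y
    exact ⟨Submodule.Quotient.mk y, rfl⟩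
  · intro y
    obtain ⟨y, rfl⟩ := Submodule.Quotient.mk_surjective _ y
    rw [Submodule.mapQ_apply, Submodule.Quotient.mk_eq_zero]
    constructor
    · intro hy
      exact ⟨Submodule.Quotient.mk ⟨y, hy⟩, rfl⟩
    · rintro ⟨z, hz⟩
      obtain ⟨z, rfl⟩ := Submodule.Quotient.mk_surjective _ z
      rw [Submodule.mapQ_apply, Submodule.Quotient.eq] at hz
      have hz' : (z : M) - y ∈ C := hz
      have := B.sub_mem z.2 (hCB hz')
      rw [sub_sub_cancel] at this
      exact this

theorem lengthQuot_map (f : M →ₗ[R] N) (hf : Function.Injective f) (A B : Submodule R M) :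
    lengthQuot (A.map f) (B.map f) = lengthQuot A B := by
  refine (LinearEquiv.length_eq (Submodule.Quotient.equiv _ _
    (Submodule.equivMapOfInjective f hf A) ?_)).symm
  ext ⟨y, hy⟩
  simp only [Submodule.mem_map]
  constructor
  · rintro ⟨z, hz, hzy⟩
    exact ⟨z, hz, congrArg Subtype.val hzy⟩
  · rintro ⟨z, hz, hzy⟩
    obtain rfl : f z = y := hzy
    obtain ⟨w, hw, hwz⟩ := hy
    obtain rfl := hf hwz
    exact ⟨⟨w, hw⟩, hz, rfl⟩

theorem lengthQuot_self (A : Submodule R M) : lengthQuot A A = 0 := by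
  rw [lengthQuot, Submodule.submoduleOf_self]
  exact Module.length_eq_zero

theorem lengthQuot_eq_one_iff {A B : Submodule R M} (h : B ≤ A) : lengthQuot A B = 1 ↔ B ⋖ A := by
  rw [covBy_iff_quot_is_simple h, lengthQuot, Module.length_eq_one_iff]
  rfl

end Length

/-! ### Quotients of length one over a local ring -/

section Local

variable {R : Type*} [CommRing R] [IsLocalRing R]

theorem lengthQuot_eq_one_of_generator {M : Type*} [AddCommGroup M] [Module R M]
    {A B : Submodule R M} {w : M} (hBA : B ≤ A) (hw : w ∈ A) (hwB : w ∉ B)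
    (hm : ∀ c ∈ maximalIdeal R, c • w ∈ B) (hA : ∀ y ∈ A, ∃ c : R, y - c • w ∈ B) :
    lengthQuot A B = 1 := by
  rw [lengthQuot_eq_one_iff hBA]
  refine ⟨lt_of_le_of_ne hBA fun h => hwB (h ▸ hw), fun C hBC hCA => ?_⟩
  obtain ⟨y, hyC, hyB⟩ := SetLike.exists_of_lt hBC
  obtain ⟨c, hc⟩ := hA y (hCA.le hyC)
  have hcu : IsUnit c := by
    by_contra hcu
    exact hyB (by simpa using B.add_mem hc (hm c hcu))
  have hcw : c • w ∈ C := by simpa using C.sub_mem hyC (hBC.le hc)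
  have hwC : w ∈ C := (C.smul_mem_iff_of_isUnit hcu).1 hcw
  refine hCA.not_ge fun z hz => ?_
  obtain ⟨d, hd⟩ := hA z hz
  simpa using C.add_mem (hBC.le hd) (C.smul_mem d hwC)

theorem smul_mem_of_lengthQuot_eq_one {M : Type*} [AddCommGroup M] [Module R M]
    {A B : Submodule R M} (h : lengthQuot A B = 1) {c : R} (hc : c ∈ maximalIdeal R)
    {y : M} (hy : y ∈ A) : c • y ∈ B := by
  rw [lengthQuot, Module.length_eq_one_iff] at h
  have hmax : (Module.annihilator R (A ⧸ B.submoduleOf A)).IsMaximal :=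
    IsSimpleModule.annihilator_isMaximal
  rw [← eq_maximalIdeal hmax, Module.mem_annihilator] at hc
  have := hc (Submodule.Quotient.mk ⟨y, hy⟩)
  rw [← Submodule.Quotient.mk_smul, Submodule.Quotient.mk_eq_zero] at this
  exact this

end Local

/-! ### Finite colength in dimension one -/

section Domain

theorem lengthQuot_span_mul {R : Type*} [CommRing R] [IsDomain R] {x : R} (hx : x ≠ 0)
    (A B : Ideal R) :
    lengthQuot (Ideal.span {x} * A) (Ideal.span {x} * B) = lengthQuot A B := by
  have h : ∀ I : Ideal R, Ideal.span {x} * I = Submodule.map (LinearMap.mulLeft R x) I := by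
    intro I
    ext y
    simp [Ideal.mem_span_singleton_mul]
  rw [h, h]
  exact lengthQuot_map (LinearMap.mulLeft R x) (mul_right_injective₀ hx) A B

variable {R : Type*} [CommRing R] [IsDomain R] [IsNoetherianRing R] [Ring.KrullDimLE 1 R]

theorem lengthQuot_top_ne_top {I : Ideal R} (hI : I ≠ ⊥) : lengthQuot ⊤ I ≠ ⊤ := by
  have h0 : Ring.KrullDimLE 0 (R ⧸ I) := .mk₀ fun P hP => by
    have hle : I ≤ P.comap (Ideal.Quotient.mk I) := by
      intro y hy
      rw [Ideal.mem_comap, Ideal.Quotient.eq_zero_iff_mem.2 hy]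
      exact P.zero_mem
    have hne : P.comap (Ideal.Quotient.mk I) ≠ ⊥ := fun h => hI (le_bot_iff.1 (h ▸ hle))
    have := (hP.comap (Ideal.Quotient.mk I)).isMaximal_of_ne_bot hne
    rw [← Ideal.map_comap_of_surjective _ Ideal.Quotient.mk_surjective P]
    exact Ideal.IsMaximal.map_of_surjective_of_ker_le Ideal.Quotient.mk_surjective
      (by rwa [Ideal.mk_ker])
  have : IsArtinianRing (R ⧸ I) := IsNoetherianRing.isArtinianRing_of_krullDimLE_zero
  have hlen : Module.length R (R ⧸ I) ≠ ⊤ := by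
    rw [Module.length_eq_of_surjective (S := R) (R := R ⧸ I) Ideal.Quotient.mk_surjective]
    exact Module.length_ne_top
  refine ne_top_of_le_ne_top hlen (LinearEquiv.length_eq (Submodule.Quotient.equiv _ _
    Submodule.topEquiv ?_)).le
  ext y
  simp
  rfl

theorem lengthQuot_ne_top {I A : Ideal R} (hI : I ≠ ⊥) (hIA : I ≤ A) : lengthQuot A I ≠ ⊤ := by
  have h := lengthQuot_top_ne_top hI
  rw [lengthQuot_add hIA le_top] at h
  exact fun h' => h (by rw [h', add_top])

/-- Compare the chains `R ⊇ I ⊇ xI` and `R ⊇ xR ⊇ xI`: as `ℓ(xR/xI) = ℓ(R/I)` is finite, it cancels.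
-/
theorem lengthQuot_self_span_mul {x : R} (hx : x ≠ 0) {I : Ideal R} (hI : I ≠ ⊥) :
    lengthQuot I (Ideal.span {x} * I) = lengthQuot ⊤ (Ideal.span {x}) := by
  have h1 := lengthQuot_add (Ideal.mul_le_left (I := Ideal.span {x}) (J := I)) le_top
  have h2 := lengthQuot_add (Ideal.mul_le_right (I := Ideal.span {x}) (J := I)) le_top
  have h3 := lengthQuot_span_mul hx ⊤ I
  rw [Ideal.mul_top] at h3
  rw [h1, h3, add_comm] at h2
  exact (ENat.add_right_injective_of_ne_top (lengthQuot_top_ne_top hI)) h2.symm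

end Domain

/-! ### Multiplicity as the stable value of the Hilbert function -/

section Multiplicity

variable {R : Type*} [CommRing R]

theorem multiplicity_eq_of_eventually_const {I : Ideal R} {c N : ℕ}
    (h : ∀ n ≥ N, hilbertFun I n = c) : multiplicity I = c := by
  have hp : IsHPoly I ((1 - X) * (∑ i ∈ Finset.range N, C ((hilbertFun I i : ℤ) - c) * X ^ i) +
      C (c : ℤ)) := by
    have hs : hilbertSeries I =
        ((∑ i ∈ Finset.range N, C ((hilbertFun I i : ℤ) - c) * X ^ i : ℤ[X]) : PowerSeries ℤ) +
          PowerSeries.C (c : ℤ) * PowerSeries.mk 1 := by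
      ext n
      simp only [hilbertSeries, PowerSeries.coeff_mk, map_add, Polynomial.coeff_coe,
        PowerSeries.coeff_C_mul, Polynomial.finsetSum_coeff, Polynomial.coeff_C_mul_X_pow,
        Finset.sum_ite_eq, Finset.mem_range, Pi.one_apply, mul_one]
      split_ifs with hn
      · ring
      · rw [h n (not_lt.1 hn)]
        ring
    rw [IsHPoly, hs, mul_add, mul_left_comm, mul_comm _ (PowerSeries.mk 1),
      PowerSeries.mk_one_mul_one_sub_eq_one, mul_one]
    push_cast
    rfl
  rw [multiplicity, hp.hPoly_eq]
  simp

end Multiplicity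

/-! ### Minimal reductions and the meaning of `e = μ + 1` -/

section Reduction

variable {R : Type*} [CommRing R] {I : Ideal R} {x : R}

theorem IsMinimalReduction.pow_succ_eq (hx : IsMinimalReduction I x) {n : ℕ}
    (hn : reductionExponent I x ≤ n) : I ^ (n + 1) = Ideal.span {x} * I ^ n :=
  Nat.sInf_mem (s := {N : ℕ | ∀ n ≥ N, I ^ (n + 1) = Ideal.span {x} * I ^ n}) hx.2 n hn

theorem reductionExponent_le {n : ℕ} (h : I ^ (n + 1) = Ideal.span {x} * I ^ n) :
    reductionExponent I x ≤ n := by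
  refine Nat.sInf_le fun k hk => ?_
  induction k, hk using Nat.le_induction with
  | base => exact h
  | succ k _ ih => rw [pow_succ, ih, mul_assoc, ← pow_succ, ih]

theorem IsMinimalReduction.pow_add_eq (hx : IsMinimalReduction I x) (k : ℕ) :
    I ^ (reductionExponent I x + k) = Ideal.span {x ^ k} * I ^ reductionExponent I x := by
  induction k with
  | zero => simp
  | succ k ih =>
    rw [← add_assoc, hx.pow_succ_eq (Nat.le_add_right _ _), ih, ← mul_assoc,
      Ideal.span_singleton_mul_span_singleton, ← pow_succ']

theorem IsMinimalReduction.span_mul_pow_le (hx : IsMinimalReduction I x) (n : ℕ) :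
    Ideal.span {x} * I ^ n ≤ I ^ (n + 1) := by
  rw [pow_succ']
  exact Ideal.mul_mono_left ((Ideal.span_singleton_le_iff_mem I).2 hx.1)

variable [IsDomain R]

theorem IsMinimalReduction.ne_zero (hx : IsMinimalReduction I x) (hI : I ≠ ⊥) : x ≠ 0 := by
  rintro rfl
  obtain ⟨N, hN⟩ := hx.2
  have := hN N le_rfl
  rw [Ideal.span_singleton_eq_bot.2 rfl, Ideal.bot_mul] at this
  exact pow_ne_zero (N + 1) hI this

variable [IsLocalRing R] [IsNoetherianRing R]

/-- Otherwise `m^(N+1) = x m^N ⊆ m^(N+2)`, and Nakayama kills `m^(N+1)`. -/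
theorem IsMinimalReduction.notMem_sq (hx : IsMinimalReduction (maximalIdeal R) x)
    (hm : maximalIdeal R ≠ ⊥) : x ∉ maximalIdeal R ^ 2 := by
  intro h
  obtain ⟨N, hN⟩ := hx.2
  have hle : maximalIdeal R ^ (N + 1) ≤ maximalIdeal R • maximalIdeal R ^ (N + 1) := by
    rw [smul_eq_mul, ← pow_succ', hN N le_rfl, show N + 1 + 1 = 2 + N by ring, pow_add]
    exact Ideal.mul_mono_left ((Ideal.span_singleton_le_iff_mem _).2 h)
  have := Submodule.eq_bot_of_le_smul_of_le_jacobson_bot _ _ (IsNoetherian.noetherian _) hle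
    (maximalIdeal_le_jacobson _)
  exact pow_ne_zero (N + 1) hm this

theorem IsMinimalReduction.mem_of_mul_mem_sq (hx : IsMinimalReduction (maximalIdeal R) x)
    (hm : maximalIdeal R ≠ ⊥) {r : R} (h : x * r ∈ maximalIdeal R ^ 2) : r ∈ maximalIdeal R := by
  by_contra hr
  have hu : IsUnit r := by simpa using hr
  exact hx.notMem_sq hm ((Ideal.mul_unit_mem_iff_mem _ hu).1 h)

variable [Ring.KrullDimLE 1 R]

theorem IsMinimalReduction.lengthQuot_pow_succ (hx : IsMinimalReduction (maximalIdeal R) x)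
    (hm : maximalIdeal R ≠ ⊥) (n : ℕ) :
    lengthQuot ⊤ (Ideal.span {x}) =
      lengthQuot (maximalIdeal R ^ n) (maximalIdeal R ^ (n + 1)) +
        lengthQuot (maximalIdeal R ^ (n + 1)) (Ideal.span {x} * maximalIdeal R ^ n) := by
  rw [← lengthQuot_self_span_mul (hx.ne_zero hm) (pow_ne_zero n hm)]
  exact lengthQuot_add (hx.span_mul_pow_le n) (Ideal.pow_le_pow_right (Nat.le_succ n))

theorem IsMinimalReduction.multiplicity_eq (hx : IsMinimalReduction (maximalIdeal R) x)
    (hm : maximalIdeal R ≠ ⊥) :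
    multiplicity (maximalIdeal R) = (lengthQuot ⊤ (Ideal.span {x})).toNat := by
  refine multiplicity_eq_of_eventually_const (N := reductionExponent (maximalIdeal R) x)
    fun n hn => ?_
  rw [hilbertFun, hx.lengthQuot_pow_succ hm n, hx.pow_succ_eq hn, lengthQuot_self, add_zero]

theorem IsMinimalReduction.lengthQuot_sq (hx : IsMinimalReduction (maximalIdeal R) x)
    (hm : maximalIdeal R ≠ ⊥) (he : multiplicity (maximalIdeal R) = (embDim R : ℤ) + 1) :
    lengthQuot (maximalIdeal R ^ 2) (Ideal.span {x} * maximalIdeal R) = 1 := by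
  have h := hx.lengthQuot_pow_succ hm 1
  have hfin := lengthQuot_top_ne_top (mt Ideal.span_singleton_eq_bot.1 (hx.ne_zero hm))
  rw [hx.multiplicity_eq hm, embDim] at he
  rw [pow_one, one_add_one_eq_two] at h
  rw [h] at hfin he
  replace hfin := WithTop.add_ne_top.1 hfin
  lift lengthQuot (maximalIdeal R) (maximalIdeal R ^ 2) to ℕ using hfin.1 with p
  lift lengthQuot (maximalIdeal R ^ 2) (Ideal.span {x} * maximalIdeal R) to ℕ using hfin.2 with q
  rw [← Nat.cast_add, ENat.toNat_natCast, ENat.toNat_natCast] at he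
  norm_cast
  omega

end Reduction

/-! ### Orders in the discrete valuation ring -/

section Order

variable {R V : Type*} [CommRing R] [CommRing V] [IsDomain V] [IsDiscreteValuationRing V]
  [Algebra R V]

variable (V) in
/-- The order of an element of `R` in a discrete valuation ring `V` over `R`. -/
def ordV (r : R) : ℕ∞ := IsDiscreteValuationRing.addVal V (algebraMap R V r)

theorem ordV_mul (r s : R) : ordV V (r * s) = ordV V r + ordV V s := by
  rw [ordV, map_mul, IsDiscreteValuationRing.addVal_mul]
  rfl

theorem ordV_ne_top [FaithfulSMul R V] {r : R} (hr : r ≠ 0) : ordV V r ≠ ⊤ := by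
  rw [ordV, Ne, IsDiscreteValuationRing.addVal_eq_top_iff]
  simpa using hr

/-- Take `t` of least order in `I^N`; then `yt = xs` with `s ∈ I^N`, and `s` has order at least that
of `t`. -/
theorem IsMinimalReduction.ordV_le [IsDomain R] [FaithfulSMul R V] {I : Ideal R} (hI : I ≠ ⊥)
    {x : R} (hx : IsMinimalReduction I x) {y : R} (hy : y ∈ I) : ordV V x ≤ ordV V y := by
  obtain ⟨N, hN⟩ := hx.2
  have hne : ((I ^ N : Ideal R) : Set R).Nonempty := ⟨0, (I ^ N).zero_mem⟩
  obtain ⟨t, ht, hmin⟩ := exists_minimalFor_of_wellFoundedLT (· ∈ I ^ N) (ordV V) hne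
  have hmin' : ∀ s ∈ I ^ N, ordV V t ≤ ordV V s := fun s hs =>
    (le_total (ordV V t) (ordV V s)).elim id fun h => hmin hs h
  obtain ⟨u, hu, hu0⟩ := Submodule.exists_mem_ne_zero_of_ne_bot (pow_ne_zero N hI)
  have htop : ordV V t ≠ ⊤ := ne_top_of_le_ne_top (ordV_ne_top hu0) (hmin' u hu)
  have hyt : y * t ∈ I ^ (N + 1) := by
    rw [pow_succ']
    exact Ideal.mul_mem_mul hy ht
  rw [hN N le_rfl, Ideal.mem_span_singleton_mul] at hyt
  obtain ⟨s, hs, hst⟩ := hyt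
  have h := congrArg (ordV V) hst
  rw [ordV_mul, ordV_mul] at h
  have : ordV V x + ordV V t ≤ ordV V y + ordV V t := h ▸ add_le_add_right (hmin' s hs) _
  exact (ENat.add_le_add_iff_right htop).1 this

theorem exists_lt_ordV_sub [IsLocalRing R] [FaithfulSMul R V]
    (hres : Function.Surjective ((residue V).comp (algebraMap R V)))
    {x y : R} (hx : x ≠ 0) (h : ordV V x ≤ ordV V y) : ∃ u : R, ordV V x < ordV V (y - u * x) := by
  rw [ordV, ordV, IsDiscreteValuationRing.addVal_le_iff_dvd] at h
  obtain ⟨c, hc⟩ := h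
  obtain ⟨u, hu⟩ := hres (residue V c)
  refine ⟨u, ?_⟩
  have hcu : c - algebraMap R V u ∈ maximalIdeal V := by
    rw [← residue_eq_zero_iff, map_sub, ← hu]
    exact sub_self _
  have h1 : IsDiscreteValuationRing.addVal V (c - algebraMap R V u) ≠ 0 := by
    rw [Ne, IsDiscreteValuationRing.addVal_eq_zero_iff]
    exact hcu
  have h2 : ordV V (y - u * x) =
      ordV V x + IsDiscreteValuationRing.addVal V (c - algebraMap R V u) := by
    rw [ordV, ordV, ← IsDiscreteValuationRing.addVal_mul, map_sub, map_mul, hc]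
    congr 1
    ring
  rw [h2, add_comm]
  exact ENat.lt_add_left (ordV_ne_top hx) (pos_iff_ne_zero.2 h1)

end Order

/-! ### Powers of the ideal modulo `x` -/

section Generator

variable {R : Type*} [CommRing R] {I : Ideal R} {x a b : R}

theorem pow_mul_mem_pow_succ (ha : a ∈ I) (hb : b ∈ I) (n : ℕ) : a ^ n * b ∈ I ^ (n + 1) := by
  rw [pow_succ]
  exact Ideal.mul_mem_mul (Ideal.pow_mem_pow ha n) hb

/-- For `c ∈ I`, reducing `cb` to a multiple of `ab` modulo `xI` turns `c a^(n+1) b` into a multiple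
of `a^(n+2) b` modulo `x I^(n+2)`. -/
theorem pow_le_sup_of_sq_le_sup (ha : a ∈ I) (hb : b ∈ I)
    (hab : I ^ 2 ≤ Ideal.span {x} * I ⊔ Ideal.span {a * b}) (n : ℕ) :
    I ^ (n + 2) ≤ Ideal.span {x} * I ^ (n + 1) ⊔ Ideal.span {a ^ (n + 1) * b} := by
  induction n with
  | zero => simpa using hab
  | succ n ih =>
    rw [show n + 1 + 2 = (n + 2) + 1 by ring, pow_succ']
    refine (Ideal.mul_mono_right ih).trans ?_
    rw [Ideal.mul_sup, mul_left_comm, ← pow_succ']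
    refine sup_le le_sup_left ?_
    rw [Ideal.mul_le]
    intro c hc d hd
    obtain ⟨r, rfl⟩ := Ideal.mem_span_singleton'.1 hd
    have hcb : c * b ∈ I ^ 2 := by
      rw [pow_two]
      exact Ideal.mul_mem_mul hc hb
    obtain ⟨y, hy, z, hz, hyz⟩ := Submodule.mem_sup.1 (hab hcb)
    obtain ⟨y, hyI, rfl⟩ := Ideal.mem_span_singleton_mul.1 hy
    obtain ⟨s, rfl⟩ := Ideal.mem_span_singleton'.1 hz
    have : c * (r * (a ^ (n + 1) * b)) = x * (r * (a ^ (n + 1) * y)) +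
        (r * s) * (a ^ (n + 1 + 1) * b) := by
      linear_combination (-r * a ^ (n + 1)) * hyz
    rw [this]
    refine Submodule.add_mem_sup ?_ (Ideal.mul_mem_left _ _ (Ideal.mem_span_singleton_self _))
    exact Ideal.mem_span_singleton_mul.2 ⟨_, Ideal.mul_mem_left _ _ (pow_mul_mem_pow_succ ha hyI _),
      rfl⟩

end Generator

/-! ### Hilbert function below the reduction exponent -/

section AlmostMaximal

variable {R : Type*} [CommRing R] [IsLocalRing R] {x a b : R}

theorem sq_le_of_lengthQuot
    (h1 : lengthQuot (maximalIdeal R ^ 2) (Ideal.span {x} * maximalIdeal R) = 1)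
    (hx : x ∈ maximalIdeal R) (ha : a ∈ maximalIdeal R) (hb : b ∈ maximalIdeal R)
    (hab : a * b ∉ Ideal.span {x} * maximalIdeal R) :
    maximalIdeal R ^ 2 ≤ Ideal.span {x} * maximalIdeal R ⊔ Ideal.span {a * b} := by
  have hle : Ideal.span {x} * maximalIdeal R ≤ maximalIdeal R ^ 2 := by
    rw [pow_two]
    exact Ideal.mul_mono_left ((Ideal.span_singleton_le_iff_mem _).2 hx)
  have hcov := (lengthQuot_eq_one_iff hle).1 h1
  have hab2 : a * b ∈ maximalIdeal R ^ 2 := by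
    rw [pow_two]
    exact Ideal.mul_mem_mul ha hb
  have hsup : Ideal.span {x} * maximalIdeal R ⊔ Ideal.span {a * b} ≤ maximalIdeal R ^ 2 :=
    sup_le hle ((Ideal.span_singleton_le_iff_mem _).2 hab2)
  rcases hcov.eq_or_eq le_sup_left hsup with h | h
  · exact absurd (h ▸ Ideal.mem_sup_right (Ideal.mem_span_singleton_self _)) hab
  · exact h.ge

/-- The quotient is generated by `a^(n+1) b`, which `m` kills because `m · ab ⊆ xm`. It is nonzero
because equality in degree `n + 1` would bound `ν` by `n + 1`. -/
theorem IsMinimalReduction.lengthQuot_pow (hx : IsMinimalReduction (maximalIdeal R) x)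
    (h1 : lengthQuot (maximalIdeal R ^ 2) (Ideal.span {x} * maximalIdeal R) = 1)
    (ha : a ∈ maximalIdeal R) (hb : b ∈ maximalIdeal R)
    (hab : a * b ∉ Ideal.span {x} * maximalIdeal R) {n : ℕ}
    (hn : n + 1 < reductionExponent (maximalIdeal R) x) :
    lengthQuot (maximalIdeal R ^ (n + 2)) (Ideal.span {x} * maximalIdeal R ^ (n + 1)) = 1 := by
  have hgen := pow_le_sup_of_sq_le_sup ha hb (sq_le_of_lengthQuot h1 hx.1 ha hb hab) n
  have hle := hx.span_mul_pow_le (n + 1)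
  have hw := pow_mul_mem_pow_succ ha hb (n + 1)
  refine lengthQuot_eq_one_of_generator hle hw ?_ ?_ ?_
  · intro h
    refine hn.not_ge (reductionExponent_le (le_antisymm (hgen.trans ?_) hle))
    exact sup_le le_rfl ((Ideal.span_singleton_le_iff_mem _).2 h)
  · intro c hc
    have hab2 : a * b ∈ maximalIdeal R ^ 2 := by
      rw [pow_two]
      exact Ideal.mul_mem_mul ha hb
    obtain ⟨y, hy, hyc⟩ := Ideal.mem_span_singleton_mul.1 (smul_mem_of_lengthQuot_eq_one h1 hc hab2)
    refine Ideal.mem_span_singleton_mul.2 ⟨a ^ n * y, pow_mul_mem_pow_succ ha hy n, ?_⟩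
    simp only [smul_eq_mul] at hyc ⊢
    linear_combination a ^ n * hyc
  · intro y hy
    obtain ⟨z, hz, w, hw, rfl⟩ := Submodule.mem_sup.1 (hgen hy)
    obtain ⟨c, rfl⟩ := Ideal.mem_span_singleton'.1 hw
    exact ⟨c, by simpa using hz⟩

variable [IsDomain R] [IsNoetherianRing R] [Ring.KrullDimLE 1 R]

theorem IsMinimalReduction.lengthQuot_top_pow (hx : IsMinimalReduction (maximalIdeal R) x)
    (hm : maximalIdeal R ≠ ⊥)
    (h1 : lengthQuot (maximalIdeal R ^ 2) (Ideal.span {x} * maximalIdeal R) = 1)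
    (ha : a ∈ maximalIdeal R) (hb : b ∈ maximalIdeal R)
    (hab : a * b ∉ Ideal.span {x} * maximalIdeal R) {n : ℕ}
    (hn : n + 1 ≤ reductionExponent (maximalIdeal R) x) :
    lengthQuot ⊤ (maximalIdeal R ^ (n + 1)) + n = 1 + n * lengthQuot ⊤ (Ideal.span {x}) := by
  induction n with
  | zero =>
    rw [zero_add, pow_one, Nat.cast_zero, zero_mul, add_zero, add_zero,
      lengthQuot_eq_one_iff le_top]
    exact covBy_top_iff.2 (maximalIdeal.isMaximal R).1
  | succ n ih =>
    have h2 := hx.lengthQuot_pow_succ hm (n + 1)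
    rw [hx.lengthQuot_pow h1 ha hb hab hn] at h2
    rw [lengthQuot_add (Ideal.pow_le_pow_right (Nat.le_succ (n + 1))) le_top]
    push_cast
    calc _ = (lengthQuot ⊤ (maximalIdeal R ^ (n + 1)) + n) +
        (lengthQuot (maximalIdeal R ^ (n + 1)) (maximalIdeal R ^ (n + 1 + 1)) + 1) := by ring
      _ = _ := by
        rw [ih (Nat.le_of_succ_le hn), ← h2]
        ring

end AlmostMaximal

/-! ### A product of maximal order outside `xm` -/

section MaximalPair

variable {R V : Type*} [CommRing R] [CommRing V] [IsDomain V]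
  [IsDiscreteValuationRing V] [Algebra R V] [FaithfulSMul R V]

theorem mem_span_of_ordV_le {f r : R}
    (hf : ∀ v : V, ∃ s : R, algebraMap R V s = algebraMap R V f * v)
    {y : R} (h : ordV V (y * f) ≤ ordV V r) : r ∈ Ideal.span {y} := by
  rw [ordV, ordV, IsDiscreteValuationRing.addVal_le_iff_dvd] at h
  obtain ⟨v, hv⟩ := h
  obtain ⟨s, hs⟩ := hf v
  refine Ideal.mem_span_singleton'.2 ⟨s, FaithfulSMul.algebraMap_injective R V ?_⟩
  rw [hv, map_mul, map_mul, hs]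
  ring

variable [IsDomain R] [IsLocalRing R]

theorem exists_maximal_pair (hm : maximalIdeal R ≠ ⊥)
    (hres : Function.Surjective ((residue V).comp (algebraMap R V)))
    {f : R} (hf0 : f ≠ 0) (hf : ∀ v : V, ∃ s : R, algebraMap R V s = algebraMap R V f * v)
    {x : R} (hx : IsMinimalReduction (maximalIdeal R) x)
    (hne : ¬ maximalIdeal R ^ 2 ≤ Ideal.span {x} * maximalIdeal R) :
    ∃ a ∈ maximalIdeal R, ∃ b ∈ maximalIdeal R, a * b ∉ Ideal.span {x} * maximalIdeal R ∧
      ordV V x < ordV V a ∧ ∀ z ∈ maximalIdeal R, ordV V b < ordV V z →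
        a * z ∈ Ideal.span {x} * maximalIdeal R := by
  set J := Ideal.span {x} * maximalIdeal R with hJ
  let S : Set ℕ := {n | ∃ a ∈ maximalIdeal R, ∃ b ∈ maximalIdeal R, a * b ∉ J ∧
    ordV V (a * b) = n}
  have hx0 : x ≠ 0 := hx.ne_zero hm
  have hfin : ∀ r : R, r ∉ J → ordV V r ≠ ⊤ := fun r hr =>
    ordV_ne_top fun h => hr (h ▸ J.zero_mem)
  have hS : S.Nonempty := by
    rw [pow_two, Ideal.mul_le] at hne
    push Not at hne
    obtain ⟨a, ha, b, hb, hab⟩ := hne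
    exact ⟨(ordV V (a * b)).toNat, a, ha, b, hb, hab, (ENat.natCast_toNat (hfin _ hab)).symm⟩
  have hSb : BddAbove S := by
    -- An element of order at least that of `x^2 f` lies in `x^2 R ⊆ xm`, by the conductor property
    -- of `f`.
    refine ⟨(ordV V (x * x * f)).toNat, ?_⟩
    rintro n ⟨a, ha, b, hb, hab, hn⟩
    rw [← Nat.cast_le (α := ℕ∞), ENat.natCast_toNat (ordV_ne_top (by simp [hx0, hf0])), ← hn]
    by_contra hlt
    refine hab (Ideal.span_le.2 ?_ (mem_span_of_ordV_le hf (not_le.1 hlt).le))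
    rw [Set.singleton_subset_iff]
    exact Ideal.mul_mem_mul (Ideal.mem_span_singleton_self x) hx.1
  obtain ⟨a, ha, b, hb, hab, hn⟩ := Nat.sSup_mem hS hSb
  have hmax : ∀ a' ∈ maximalIdeal R, ∀ b' ∈ maximalIdeal R, ordV V (a * b) < ordV V (a' * b') →
      a' * b' ∈ J := by
    intro a' ha' b' hb' hlt
    by_contra hab'
    have := le_csSup hSb (show (ordV V (a' * b')).toNat ∈ S from
      ⟨a', ha', b', hb', hab', (ENat.natCast_toNat (hfin _ hab')).symm⟩)
    rw [← Nat.cast_le (α := ℕ∞), ENat.natCast_toNat (hfin _ hab'), ← hn] at this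
    exact hlt.not_ge this
  have hb0 : ordV V b ≠ ⊤ := ordV_ne_top fun h => hab (by simp [h])
  have ha0 : ordV V a ≠ ⊤ := ordV_ne_top fun h => hab (by simp [h])
  refine ⟨a, ha, b, hb, hab, ?_, fun z hz hlt => hmax a ha z hz ?_⟩
  · refine lt_of_le_of_ne (hx.ordV_le hm ha) fun heq => hab ?_
    -- If `a` had the order of `x`, residual rationality would give `a - ux` of larger order; `(a -
    -- ux)b` is congruent to `ab` modulo `xm`, against maximality.
    obtain ⟨u, hu⟩ := exists_lt_ordV_sub hres hx0 heq.le
    have h := hmax (a - u * x) (sub_mem ha (Ideal.mul_mem_left _ _ hx.1)) b hb (by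
      rw [ordV_mul, ordV_mul, ← heq]
      exact (ENat.add_lt_add_iff_right hb0).2 hu)
    have h2 : x * (u * b) ∈ J :=
      Ideal.mul_mem_mul (Ideal.mem_span_singleton_self x) (Ideal.mul_mem_left _ _ hb)
    have h3 := J.add_mem h h2
    rwa [show (a - u * x) * b + x * (u * b) = a * b by ring] at h3
  · rw [ordV_mul, ordV_mul]
    exact (ENat.add_lt_add_iff_left ha0).2 hlt

end MaximalPair

/-! ### The colon ideals and the length-one step -/

section Conductor

variable {R : Type*} [CommRing R] {x : R}

/-- The ideal of all `y` with `y I^n ⊆ x^n R`, that is `R : x⁻ⁿ Iⁿ`. -/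
def colonPow (I : Ideal R) (x : R) (n : ℕ) : Ideal R :=
  (Ideal.span {x ^ n}).colon ((I ^ n : Ideal R) : Set R)

theorem mem_colonPow {I : Ideal R} {n : ℕ} {y : R} :
    y ∈ colonPow I x n ↔ ∀ t ∈ I ^ n, x ^ n ∣ y * t := by
  simp [colonPow, Submodule.mem_colon, Ideal.mem_span_singleton]

theorem mem_colonPow_one {I : Ideal R} {y : R} :
    y ∈ colonPow I x 1 ↔ ∀ t ∈ I, x ∣ y * t := by
  rw [mem_colonPow, pow_one, pow_one]

theorem span_le_colonPow_one (I : Ideal R) : Ideal.span {x} ≤ colonPow I x 1 := by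
  rw [Ideal.span_singleton_le_iff_mem, mem_colonPow_one]
  exact fun t _ => dvd_mul_right x t

/-- Because `I^ν I^ν = x^ν I^ν`. -/
theorem IsMinimalReduction.pow_le_colonPow {I : Ideal R} (hx : IsMinimalReduction I x) :
    I ^ reductionExponent I x ≤ colonPow I x (reductionExponent I x) := by
  intro y hy
  rw [mem_colonPow]
  intro t ht
  have h := Ideal.mul_mem_mul hy ht
  rw [← pow_add, hx.pow_add_eq, Ideal.mem_span_singleton_mul] at h
  obtain ⟨z, -, hz⟩ := h
  exact ⟨z, hz.symm⟩

theorem colonPow_le_colonPow_one [IsDomain R] {I : Ideal R} (hx : x ∈ I) (hx0 : x ≠ 0) (n : ℕ) :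
    colonPow I x (n + 1) ≤ colonPow I x 1 := by
  intro y hy
  rw [mem_colonPow_one]
  intro t ht
  obtain ⟨c, hc⟩ := mem_colonPow.1 hy (x ^ n * t) (pow_mul_mem_pow_succ hx ht n)
  refine ⟨c, mul_left_cancel₀ (pow_ne_zero n hx0) ?_⟩
  linear_combination hc

theorem mem_colonPow_of_generator {I : Ideal R} {a b y : R} (ha : a ∈ I) (hb : b ∈ I)
    (hab : I ^ 2 ≤ Ideal.span {x} * I ⊔ Ideal.span {a * b}) (hy : y ∈ colonPow I x 1)
    (hyn : ∀ n, x ^ (n + 2) ∣ y * (a ^ (n + 1) * b)) (n : ℕ) : y ∈ colonPow I x (n + 1) := by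
  induction n with
  | zero => exact hy
  | succ n ih =>
    rw [mem_colonPow] at ih ⊢
    intro t ht
    obtain ⟨z, hz, w, hw, rfl⟩ := Submodule.mem_sup.1 (pow_le_sup_of_sq_le_sup ha hb hab n ht)
    obtain ⟨z, hzI, rfl⟩ := Ideal.mem_span_singleton_mul.1 hz
    obtain ⟨s, rfl⟩ := Ideal.mem_span_singleton'.1 hw
    rw [mul_add]
    refine dvd_add ?_ ?_
    · rw [mul_left_comm, pow_succ']
      exact mul_dvd_mul_left _ (ih z hzI)
    · rw [mul_left_comm]
      exact (hyn n).mul_left s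

variable {V : Type*} [CommRing V] [IsDomain V] [IsDiscreteValuationRing V] [Algebra R V]
  [FaithfulSMul R V] {I : Ideal R} {a b : R}

/-- Writing `az = xw`, the inequality between the orders of `x` and `a` gives `w` order at least
that of `z`, so the exchange can be repeated with `w`. -/
theorem pow_dvd_pow_mul_of_ordV_lt (hx0 : x ≠ 0) (hlt : ordV V x < ordV V a)
    (hmax : ∀ z ∈ I, ordV V b < ordV V z → a * z ∈ Ideal.span {x} * I) (n : ℕ) :
    ∀ z ∈ I, ordV V b < ordV V z → x ^ n ∣ a ^ n * z := by
  induction n with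
  | zero => simp
  | succ n ih =>
    intro z hz hbz
    obtain ⟨w, hw, hwz⟩ := Ideal.mem_span_singleton_mul.1 (hmax z hz hbz)
    have h := congrArg (ordV V) hwz
    rw [ordV_mul, ordV_mul] at h
    have hzw : ordV V z ≤ ordV V w := by
      rw [← ENat.add_le_add_iff_left (ordV_ne_top (V := V) hx0), h]
      exact add_le_add_left hlt.le _
    obtain ⟨c, hc⟩ := ih w hw (hbz.trans_le hzw)
    refine ⟨c, ?_⟩
    rw [pow_succ, mul_assoc, ← hwz, mul_left_comm, hc]
    ring

/-- Comparing orders in `yab = x^2 z` shows that `z` has larger order than `b`. Hence `x^k` divides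
`a^k z`, and `x^(k+2)` divides `y a^(k+1) b`; only these generators need testing. -/
theorem mem_colonPow_of_ordV_lt (hx0 : x ≠ 0) (ha : a ∈ I) (hb : b ∈ I) (hb0 : b ≠ 0)
    (hab : I ^ 2 ≤ Ideal.span {x} * I ⊔ Ideal.span {a * b}) (hlt : ordV V x < ordV V a)
    (hmax : ∀ z ∈ I, ordV V b < ordV V z → a * z ∈ Ideal.span {x} * I)
    {y z : R} (hy : y ∈ colonPow I x 1) (hxy : ordV V x ≤ ordV V y) (hz : z ∈ I)
    (hyz : y * (a * b) = x ^ 2 * z) (n : ℕ) : y ∈ colonPow I x (n + 1) := by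
  refine mem_colonPow_of_generator ha hb hab hy (fun k => ?_) n
  have hxt := ordV_ne_top (V := V) hx0
  have hxx : ordV V x + ordV V x ≠ ⊤ := WithTop.add_ne_top.2 ⟨hxt, hxt⟩
  have hbz : ordV V b < ordV V z := by
    have h := congrArg (ordV V) hyz
    rw [pow_two, ordV_mul, ordV_mul, ordV_mul, ordV_mul] at h
    rw [← ENat.add_lt_add_iff_left hxx, ← h, ← add_assoc]
    exact (ENat.add_lt_add_iff_right (ordV_ne_top hb0)).2
      (ENat.add_lt_add_of_le_of_lt hxt hxy hlt)
  obtain ⟨c, hc⟩ := pow_dvd_pow_mul_of_ordV_lt hx0 hlt hmax k z hz hbz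
  refine ⟨c, ?_⟩
  linear_combination a ^ k * hyz + x ^ 2 * hc

variable [IsDomain R] [IsLocalRing R] [IsNoetherianRing R]

/-- The class of `x` generates: it is nonzero because `x` does not divide `ab`, and both `mx` and a
suitable `y - cx` satisfy the equation required by `mem_colonPow_of_ordV_lt`. -/
theorem IsMinimalReduction.lengthQuot_colonPow (hx : IsMinimalReduction (maximalIdeal R) x)
    (hm : maximalIdeal R ≠ ⊥)
    (h1 : lengthQuot (maximalIdeal R ^ 2) (Ideal.span {x} * maximalIdeal R) = 1)
    (ha : a ∈ maximalIdeal R) (hb : b ∈ maximalIdeal R)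
    (hab : a * b ∉ Ideal.span {x} * maximalIdeal R) (hlt : ordV V x < ordV V a)
    (hmax : ∀ z ∈ maximalIdeal R, ordV V b < ordV V z →
      a * z ∈ Ideal.span {x} * maximalIdeal R) (n : ℕ) :
    lengthQuot (colonPow (maximalIdeal R) x 1) (colonPow (maximalIdeal R) x (n + 2)) = 1 := by
  have hx0 := hx.ne_zero hm
  have hb0 : b ≠ 0 := fun h => hab (by simp [h])
  have hsq := sq_le_of_lengthQuot h1 hx.1 ha hb hab
  have hab2 : a * b ∈ maximalIdeal R ^ 2 := by
    rw [pow_two]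
    exact Ideal.mul_mem_mul ha hb
  have hxJ : x ∈ colonPow (maximalIdeal R) x 1 :=
    span_le_colonPow_one _ (Ideal.mem_span_singleton_self x)
  have hdvd : ∀ {r : R}, r ∈ maximalIdeal R ^ 2 → x ∣ r → ∃ s ∈ maximalIdeal R, r = x * s := by
    rintro _ hr ⟨s, rfl⟩
    exact ⟨s, hx.mem_of_mul_mem_sq hm hr, rfl⟩
  have hnot : ¬ x ∣ a * b := fun h => by
    obtain ⟨s, hs, hsab⟩ := hdvd hab2 h
    exact hab (Ideal.mem_span_singleton_mul.2 ⟨s, hs, hsab.symm⟩)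
  have hJm : colonPow (maximalIdeal R) x 1 ≤ maximalIdeal R := by
    intro y hy
    by_contra hyu
    have hu : IsUnit y := by simpa using hyu
    exact hnot ((hu.dvd_mul_left.1 (mem_colonPow_one.1 hy a ha)).mul_right b)
  refine lengthQuot_eq_one_of_generator (w := x) (colonPow_le_colonPow_one hx.1 hx0 _) hxJ ?_ ?_ ?_
  · intro h
    -- Testing `x` against this element would make `x^(n+2)` divide `x^(n+1) ab`.
    have hmem : x ^ n * (a * b) ∈ maximalIdeal R ^ (n + 2) := by
      rw [pow_add]
      exact Ideal.mul_mem_mul (Ideal.pow_mem_pow hx.1 n) hab2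
    obtain ⟨c, hc⟩ := mem_colonPow.1 h _ hmem
    refine hnot ⟨c, mul_left_cancel₀ (pow_ne_zero (n + 1) hx0) ?_⟩
    linear_combination hc
  · intro c hc
    obtain ⟨z, hz, hzc⟩ := Ideal.mem_span_singleton_mul.1 (smul_mem_of_lengthQuot_eq_one h1 hc hab2)
    rw [smul_eq_mul] at hzc ⊢
    refine mem_colonPow_of_ordV_lt hx0 ha hb hb0 hsq hlt hmax (Ideal.mul_mem_left _ _ hxJ)
      (hx.ordV_le hm (Ideal.mul_mem_left _ _ hx.1)) hz ?_ (n + 1)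
    linear_combination -x * hzc
  · intro y hy
    have hym := hJm hy
    have hmul : ∀ {s t : R}, s ∈ maximalIdeal R → t ∈ maximalIdeal R →
        s * t ∈ maximalIdeal R ^ 2 := fun hs ht => by
      rw [pow_two]
      exact Ideal.mul_mem_mul hs ht
    -- From `yb = xu` and `au = xz + c ab` one gets `(y - cx)ab = x^2 z`, which determines the
    -- coefficient `c`.
    obtain ⟨u, hu, hyu⟩ := hdvd (hmul hym hb) (mem_colonPow_one.1 hy b hb)
    obtain ⟨v, hv, w, hw, hvw⟩ := Submodule.mem_sup.1 (hsq (hmul ha hu))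
    obtain ⟨z, hz, rfl⟩ := Ideal.mem_span_singleton_mul.1 hv
    obtain ⟨c, rfl⟩ := Ideal.mem_span_singleton'.1 hw
    have hmem : y - c • x ∈ colonPow (maximalIdeal R) x 1 :=
      sub_mem hy (Submodule.smul_mem _ c hxJ)
    refine ⟨c, mem_colonPow_of_ordV_lt hx0 ha hb hb0 hsq hlt hmax hmem
      (hx.ordV_le hm (hJm hmem)) hz ?_ (n + 1)⟩
    rw [smul_eq_mul]
    linear_combination a * hyu - x * hvw

end Conductor

/-! ### Blowing-up, type and conductor inside `K` -/

section Fractional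

variable {R K : Type*} [CommRing R] [Field K] [Algebra R K] [IsFractionRing R K]
  {I : Ideal R} {x : R}

/-- This is `Λ = x^(-ν) I^ν`. If `z` stabilises `I^(ν+n) = x^n I^ν`, apply it to `x^(ν+n)` and
cancel `x^n`; the converse uses `I^ν I^ν = x^ν I^ν`. -/
theorem IsMinimalReduction.mem_blowUp_iff (hx : IsMinimalReduction I x) (hx0 : x ≠ 0) {z : K} :
    z ∈ blowUp K I ↔ ∃ t ∈ I ^ reductionExponent I x,
      algebraMap R K t = z * algebraMap R K x ^ reductionExponent I x := by
  set ν := reductionExponent I x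
  have hxK : algebraMap R K x ≠ 0 := by simpa using hx0
  constructor
  · intro h
    obtain ⟨n, hn⟩ := Set.mem_iUnion.1 h
    have hn' : z ∈ inK K (I ^ (ν + n)) / inK K (I ^ (ν + n)) :=
      colon_mono K I (Nat.le_add_left n ν) hn
    have hmem : algebraMap R K (x ^ (ν + n)) ∈ inK K (I ^ (ν + n)) :=
      (IsLocalization.mem_coeSubmodule K _).2 ⟨_, Ideal.pow_mem_pow hx.1 _, rfl⟩
    obtain ⟨t, ht, htz⟩ := (IsLocalization.mem_coeSubmodule K _).1
      (Submodule.mem_div_iff_forall_mul_mem.1 hn' _ hmem)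
    rw [hx.pow_add_eq, Ideal.mem_span_singleton_mul] at ht
    obtain ⟨s, hs, rfl⟩ := ht
    refine ⟨s, hs, mul_left_cancel₀ (pow_ne_zero n hxK) ?_⟩
    simp only [map_mul, map_pow] at htz
    rw [htz]
    ring
  · rintro ⟨t, ht, htz⟩
    refine Set.mem_iUnion.2 ⟨ν, Submodule.mem_div_iff_forall_mul_mem.2 fun y hy => ?_⟩
    obtain ⟨s, hs, rfl⟩ := (IsLocalization.mem_coeSubmodule K _).1 hy
    have h := Ideal.mul_mem_mul ht hs
    rw [← pow_add, hx.pow_add_eq, Ideal.mem_span_singleton_mul] at h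
    obtain ⟨w, hw, hwts⟩ := h
    refine (IsLocalization.mem_coeSubmodule K _).2 ⟨w, hw, ?_⟩
    have h := congrArg (algebraMap R K) hwts
    rw [map_mul, map_mul, map_pow, htz] at h
    refine mul_left_cancel₀ (pow_ne_zero ν hxK) ?_
    rw [h]
    ring

theorem IsMinimalReduction.inK_colonPow (hx : IsMinimalReduction I x) (hx0 : x ≠ 0) :
    inK K (colonPow I x (reductionExponent I x)) = 1 / blowUp K I := by
  have hxK : algebraMap R K x ≠ 0 := by simpa using hx0
  ext y
  rw [IsLocalization.mem_coeSubmodule, Submodule.mem_div_iff_forall_mul_mem]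
  constructor
  · rintro ⟨y, hy, rfl⟩ z hz
    obtain ⟨t, ht, htz⟩ := (hx.mem_blowUp_iff hx0).1 hz
    obtain ⟨c, hc⟩ := mem_colonPow.1 hy t ht
    refine Submodule.mem_one.2 ⟨c, ?_⟩
    have h := congrArg (algebraMap R K) hc
    rw [map_mul, map_mul, map_pow, htz] at h
    refine mul_left_cancel₀ (pow_ne_zero (reductionExponent I x) hxK) ?_
    rw [← h]
    ring
  · intro h
    have h1 := h 1 ((hx.mem_blowUp_iff hx0).2 ⟨x ^ reductionExponent I x,
      Ideal.pow_mem_pow hx.1 _, by simp⟩)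
    rw [mul_one] at h1
    obtain ⟨r, rfl⟩ := Submodule.mem_one.1 h1
    refine ⟨r, mem_colonPow.2 fun t ht => ?_, rfl⟩
    have hz := h (algebraMap R K t / algebraMap R K x ^ reductionExponent I x)
      ((hx.mem_blowUp_iff hx0).2 ⟨t, ht, by field_simp⟩)
    obtain ⟨c, hc⟩ := Submodule.mem_one.1 hz
    refine ⟨c, IsFractionRing.injective R K ?_⟩
    rw [map_mul, map_mul, map_pow, hc]
    field_simp

theorem lengthQuot_inK (A B : Ideal R) : lengthQuot (inK K A) (inK K B) = lengthQuot A B :=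
  lengthQuot_map (Algebra.linearMap R K) (IsFractionRing.injective R K) A B

/-- Multiplication by `x` carries `R : I` onto `colonPow I x 1` and `R` onto `xR`. -/
theorem lengthQuot_one_div (hx : x ∈ I) (hx0 : x ≠ 0) :
    lengthQuot ((1 : Submodule R K) / inK K I) 1 =
      lengthQuot (colonPow I x 1) (Ideal.span {x}) := by
  have hxK : algebraMap R K x ≠ 0 := by simpa using hx0
  rw [← lengthQuot_inK (K := K),
    ← lengthQuot_map (LinearMap.mulLeft R (algebraMap R K x)) (mul_right_injective₀ hxK)]
  congr 1
  · ext y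
    simp only [Submodule.mem_map, LinearMap.mulLeft_apply, IsLocalization.mem_coeSubmodule,
      mem_colonPow_one, Submodule.mem_div_iff_forall_mul_mem, Submodule.mem_one]
    constructor
    · rintro ⟨z, hz, rfl⟩
      obtain ⟨r, hr⟩ := hz _ ⟨x, hx, rfl⟩
      refine ⟨r, fun t ht => ?_, by rw [hr, mul_comm]⟩
      obtain ⟨s, hs⟩ := hz _ ⟨t, ht, rfl⟩
      refine ⟨s, IsFractionRing.injective R K ?_⟩
      rw [map_mul, map_mul, hr, hs]
      ring
    · rintro ⟨r, hr, rfl⟩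
      refine ⟨algebraMap R K r / algebraMap R K x, ?_, by field_simp⟩
      rintro _ ⟨t, ht, rfl⟩
      obtain ⟨s, hs⟩ := hr t ht
      refine ⟨s, ?_⟩
      rw [div_mul_eq_mul_div, ← map_mul, hs, map_mul]
      field_simp
  · ext y
    simp only [Submodule.mem_map, LinearMap.mulLeft_apply, IsLocalization.mem_coeSubmodule,
      Submodule.mem_one, Ideal.mem_span_singleton]
    constructor
    · rintro ⟨_, ⟨r, rfl⟩, rfl⟩
      exact ⟨x * r, dvd_mul_right x r, by simp⟩
    · rintro ⟨_, ⟨r, rfl⟩, rfl⟩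
      exact ⟨_, ⟨r, rfl⟩, by simp⟩

variable (R K) in
-- A common denominator of finitely many module generators works.
theorem exists_conductor [IsDomain R] [Module.Finite R (integralClosure R K)] :
    ∃ f : R, f ≠ 0 ∧ ∀ v : integralClosure R K, ∃ s : R,
      algebraMap R (integralClosure R K) s = algebraMap R (integralClosure R K) f * v := by
  obtain ⟨S, hS⟩ := Module.Finite.fg_top (R := R) (M := integralClosure R K)
  obtain ⟨⟨f, hf0⟩, hf⟩ := IsLocalization.exist_integer_multiples (nonZeroDivisors R) S
    (fun v => (v : K))
  refine ⟨f, nonZeroDivisors.ne_zero hf0, fun v => ?_⟩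
  have hv : v ∈ Submodule.span R (S : Set (integralClosure R K)) := hS ▸ Submodule.mem_top
  induction hv using Submodule.span_induction with
  | mem v hv =>
    obtain ⟨s, hs⟩ := hf v hv
    refine ⟨s, Subtype.ext ?_⟩
    simpa [Algebra.smul_def] using hs
  | zero => exact ⟨0, by simp⟩
  | add v w _ _ hv hw =>
    obtain ⟨s, hs⟩ := hv
    obtain ⟨t, ht⟩ := hw
    exact ⟨s + t, by rw [map_add, hs, ht, mul_add]⟩
  | smul c v _ hv =>
    obtain ⟨s, hs⟩ := hv
    exact ⟨c * s, by rw [map_mul, hs, Algebra.smul_def, mul_left_comm]⟩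

end Fractional

end BlowUp

end

theorem theorem6p6 {R K : Type*} [CommRing R] [IsDomain R] [IsLocalRing R] [IsNoetherianRing R]
    (hdim : ringKrullDim R = 1) [Infinite (IsLocalRing.ResidueField R)]
    [Field K] [Algebra R K] [IsFractionRing R K]
    [Module.Finite R (integralClosure R K)]
    [IsDiscreteValuationRing (integralClosure R K)]
    (hres : Function.Surjective
      ((IsLocalRing.residue (integralClosure R K)).comp (algebraMap R (integralClosure R K))))
    (x : R) (hx : BlowUp.IsMinimalReduction (IsLocalRing.maximalIdeal R) x)
    (he : BlowUp.multiplicity (IsLocalRing.maximalIdeal R) = (BlowUp.embDim R : ℤ) + 1) :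
    BlowUp.inK K (IsLocalRing.maximalIdeal R ^
        BlowUp.reductionExponent (IsLocalRing.maximalIdeal R) x) ≤
      (1 : Submodule R K) / BlowUp.blowUp K (IsLocalRing.maximalIdeal R) ∧
    ∃ l : ℕ,
      BlowUp.lengthQuot ((1 : Submodule R K) / BlowUp.blowUp K (IsLocalRing.maximalIdeal R))
        (BlowUp.inK K (IsLocalRing.maximalIdeal R ^
          BlowUp.reductionExponent (IsLocalRing.maximalIdeal R) x)) = l ∧
      (l : ℤ) = (BlowUp.cmType R K : ℤ) - 1 +
        (BlowUp.multiplicity (IsLocalRing.maximalIdeal R) - 1) *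
          ((BlowUp.reductionExponent (IsLocalRing.maximalIdeal R) x : ℤ) - 2) := by
  have : Ring.KrullDimLE 1 R := Ring.krullDimLE_iff.2 (by rw [hdim]; rfl)
  have hm : maximalIdeal R ≠ ⊥ := fun h => by
    rw [ringKrullDim_eq_zero_of_isField (isField_iff_maximalIdeal_eq.2 h)] at hdim
    exact zero_ne_one hdim
  have hx0 := hx.ne_zero hm
  have h1 := hx.lengthQuot_sq hm he
  have hne : ¬ maximalIdeal R ^ 2 ≤ Ideal.span {x} * maximalIdeal R := by
    have hle := hx.span_mul_pow_le 1
    rw [pow_one, one_add_one_eq_two] at hle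
    exact ((BlowUp.lengthQuot_eq_one_iff hle).1 h1).lt.not_ge
  obtain ⟨f, hf0, hf⟩ := BlowUp.exists_conductor R K
  obtain ⟨a, ha, b, hb, hab, hlt, hmax⟩ := BlowUp.exists_maximal_pair hm hres hf0 hf hx hne
  have hpow := hx.pow_le_colonPow
  refine ⟨?_, ?_⟩
  · rw [← hx.inK_colonPow hx0]
    exact (IsLocalization.coeSubmodule_mono K) hpow
  rw [← hx.inK_colonPow hx0, BlowUp.lengthQuot_inK, hx.multiplicity_eq hm, BlowUp.cmType,
    BlowUp.lengthQuot_one_div hx.1 hx0]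
  -- `ν ≤ 1` would give `m^2 = xm`.
  obtain ⟨n, hn⟩ : ∃ n, BlowUp.reductionExponent (maximalIdeal R) x = n + 2 := by
    refine Nat.exists_eq_add_of_le' (not_lt.1 fun hlt2 => hne ?_)
    have := hx.pow_succ_eq (Nat.lt_succ_iff.1 hlt2)
    rw [pow_one, one_add_one_eq_two] at this
    exact this.le
  have hlen := hx.lengthQuot_top_pow hm h1 ha hb hab (n := n + 1) hn.ge
  have hJL := hx.lengthQuot_colonPow hm h1 ha hb hab hlt hmax n
  rw [hn] at hpow ⊢
  have hspan : Ideal.span {x} ≠ ⊥ := mt Ideal.span_singleton_eq_bot.1 hx0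
  have hLJ := BlowUp.colonPow_le_colonPow_one hx.1 hx0 (n + 1)
  have hJ := BlowUp.lengthQuot_add (BlowUp.span_le_colonPow_one (maximalIdeal R) (x := x)) le_top
  -- Split `ℓ(R/m^ν)` along `m^ν ⊆ L ⊆ x(R : m) ⊆ R`; all lengths are finite, so the rest is integer
  -- arithmetic.
  rw [BlowUp.lengthQuot_add hpow le_top, BlowUp.lengthQuot_add hLJ le_top, hJL] at hlen
  have hfin1 := BlowUp.lengthQuot_top_ne_top hspan
  have hfin2 := BlowUp.lengthQuot_ne_top (pow_ne_zero (n + 2) hm) hpow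
  rw [hJ] at hfin1 hlen ⊢
  replace hfin1 := WithTop.add_ne_top.1 hfin1
  lift BlowUp.lengthQuot ⊤ (BlowUp.colonPow (maximalIdeal R) x 1) to ℕ using hfin1.1 with p
  lift BlowUp.lengthQuot (BlowUp.colonPow (maximalIdeal R) x 1) (Ideal.span {x}) to ℕ
    using hfin1.2 with r
  lift BlowUp.lengthQuot (BlowUp.colonPow (maximalIdeal R) x (n + 2)) (maximalIdeal R ^ (n + 2))
    to ℕ using hfin2 with l
  refine ⟨l, rfl, ?_⟩
  rw [← Nat.cast_add, ENat.toNat_natCast, ENat.toNat_natCast]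
  norm_cast at hlen
  zify at hlen
  push_cast
  linear_combination hlen
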